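/- Let $p\ge 2$, $a\ge 1$, $b\in[1,p]$, $d\ge 1$ be integers with $\gcd(ap+b,d)=1$, and put $m_0=ap+b$, $m_i=m_0+id$ for $i\in[0,p]$. Let $K$ be a field, $R=K[X_1,\dots,X_p,X_0]$, and let $\wp$ be the kernel of the $K$-algebra map $\eta:R\to K[T]$, $X_i\mapsto T^{m_i}$. For $i,j\ge 0$ let $\epsilon(i,j)=i+j$ and $\tau(i,j)=0$ if $i+j<p$, and $\epsilon(i,j)=\tau(i,j)=p$ if $i+j\ge p$. Put $$\phi(i,j)=X_iX_j-X_{\epsilon(i,j)}X_{i+j-\epsilon(i,j)}\quad(i,j\in[1,p-1]),\qquad \psi(b,i)=X_{b+i}X_p^a-X_iX_0^{a+d}\quad(i\in[0,p-b]).$$ Let $M$ be the free $R$-module on the symbols $\Psi(b,i)$, $i\in[0,p-b]$, and $\Phi(i,j)$, $1\le i\le j\le p-1$, and let $N$ be the kernel of the $R$-linear map $M\to R[t]$, $\Psi(b,i)\mapsto\psi(b,i)\,t$, $\Phi(i,j)\mapsto\phi(i,j)\,t$. In $M$ put $\Phi(j,i)=\Phi(i,j)$, and $\Phi(i,j)=0$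 unless both $i,j\in[1,p-1]$. Orders. Let $\omega(X^\alpha)=\sum_{i=0}^p\alpha_im_i$. Write $X^\alpha>_RX^{\beta}$ if $\omega(X^\alpha)>\omega(X^\beta)$, or if $\omega(X^\alpha)=\omega(X^\beta)$ and the right-most non-zero entry of $(\alpha_1-\beta_1,\dots,\alpha_p-\beta_p,\alpha_0-\beta_0)$ is negative. Let $\varpi(X^\alpha\Psi(b,i))=X^\alpha X_p^aX_{b+i}$ and $\varpi(X^\alpha\Phi(i,j))=X^\alpha X_iX_j$. For monomials $X^\alpha e$, $X^{\alpha'}e'$ of $M$ write $X^\alpha e>_MX^{\alpha'}e'$ if $\varpi(X^\alpha e)>_R\varpi(X^{\alpha'}e')$, or if $\varpi(X^\alpha e)=\varpi(X^{\alpha'}e')$ and one of the following holds: $e=\Psi(b,i)$, $e'=\Psi(b,j)$ and $i<j$; $e=\Psi(b,i)$ and $e'=\Phi(l,j)$; $e=\Phi(i,j)$, $e'=\Phi(i',j')$ (with $i\le j$, $i'\le j'$) and either $j>j'$, or $j=j'$ and $i>i'$. Let $\widehat{\mathcal G}$ be the set of the elements $$\begin{aligned}A(i;b,j)={}&X_i\Psi(b,j)-X_{b+i+j-\epsilon(i,b+j)}\Psi(b,\epsilon(i,b+j)-b)-X_p^a\Phi(i,b+j)\\&+X_0^{a+d}\bigl[\Phi(i,j)-\Phi(b+i+j-p,\,p-b)\bigr],\qquad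 i\in[1,p],\ j\in[0,p-b-1],\\ B(i,j)={}&X_iX_j\Psi(b,p-b)-X_{\epsilon(i,j)}X_{i+j-\epsilon(i,j)}\Psi(b,p-b)-\psi(b,p-b)\Phi(i,j),\qquad i,j\in[1,p-1],\\ L(l;i,j)={}&X_l\Phi(i,j)-X_j\Phi(i,l)+X_{\tau(i,j)}\Phi(i+j-\tau(i,j),l)-X_{\tau(i,l)}\Phi(i+l-\tau(i,l),j),\\&\qquad l,i,j\in[1,p-1],\ i\le j,\ l<j.\end{aligned}$$ Theorem. The binomials $\psi(b,i)$ and $\phi(i,j)$ generate $\wp$ (so that $N$ is the first syzygy module of $\wp$ for these generators). The relation $>_M$ is a monomial order on $M$, and $\widehat{\mathcal G}$ is a Gröbner basis of $N$ with respect to $>_M$: it is a finite set of non-zero elements of $N$, and the leading terms of its elements generate the submodule of $M$ generated by the leading terms of all non-zero elements of $N$. -/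

import Mathlib

noncomputable section

namespace MonCurve

open MvPolynomial

/-! ### Gröbner bases in a free module over a polynomial ring -/

section Groebner

variable {σ ι K : Type*} [Field K]

/-- A monomial order on the monomials `X^α e` of the free module with basis `ι` over
`K[X_s : s ∈ σ]`. The pair `(α, e)` stands for `X^α e`, and `gt u v` for `u > v`. -/
structure IsMonomialOrder (gt : (σ →₀ ℕ) × ι → (σ →₀ ℕ) × ι → Prop) : Prop where
  irrefl : ∀ u, ¬ gt u u
  trans : ∀ u v w, gt u v → gt v w → gt u w
  total : ∀ u v, gt u v ∨ u = v ∨ gt v u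
  mul_left : ∀ (γ : σ →₀ ℕ) u v, gt u v → gt (γ + u.1, u.2) (γ + v.1, v.2)
  wf : WellFounded (fun u v => gt v u)

/-- `u` is the leading monomial of `H`: it occurs in `H`, and it is larger than every other
monomial that occurs in `H`. -/
def IsLeadingMonomial (gt : (σ →₀ ℕ) × ι → (σ →₀ ℕ) × ι → Prop)
    (H : ι →₀ MvPolynomial σ K) (u : (σ →₀ ℕ) × ι) : Prop :=
  (H u.2).coeff u.1 ≠ 0 ∧ ∀ v : (σ →₀ ℕ) × ι, (H v.2).coeff v.1 ≠ 0 → v ≠ u → gt u v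

/-- The submodule `⟨LT(S)⟩` generated by the leading monomials of the elements of `S`. -/
def leadingSubmodule (gt : (σ →₀ ℕ) × ι → (σ →₀ ℕ) × ι → Prop)
    (S : Set (ι →₀ MvPolynomial σ K)) : Submodule (MvPolynomial σ K) (ι →₀ MvPolynomial σ K) :=
  Submodule.span (MvPolynomial σ K)
    {F | ∃ H ∈ S, ∃ u, IsLeadingMonomial gt H u ∧ F = Finsupp.single u.2 (monomial u.1 1)}

/-- `G` is a Gröbner basis of the submodule `N` with respect to the monomial order `gt`. -/
structure IsGroebnerBasis (gt : (σ →₀ ℕ) × ι → (σ →₀ ℕ) × ι → Prop)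
    (N : Submodule (MvPolynomial σ K) (ι →₀ MvPolynomial σ K))
    (G : Set (ι →₀ MvPolynomial σ K)) : Prop where
  order : IsMonomialOrder gt
  finite : G.Finite
  subset : G ⊆ (N : Set (ι →₀ MvPolynomial σ K))
  ne_zero : ∀ g ∈ G, g ≠ 0
  leading : leadingSubmodule gt G = leadingSubmodule gt (N : Set (ι →₀ MvPolynomial σ K))

end Groebner

/-! ### The monomial curve -/

/-- `m_i = m_0 + i d`, where `m_0 = a p + b`. -/
def m (p a b d i : ℕ) : ℕ := a * p + b + i * d

/-- The polynomial ring `R = K[X_1, …, X_p, X_0]`. -/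
abbrev R (K : Type*) [Field K] (p : ℕ) : Type _ := MvPolynomial (Fin (p + 1)) K

/-- An index `i ∈ [0, p]` as an element of `Fin (p + 1)`; only used for `i ≤ p`. -/
def idx (p i : ℕ) : Fin (p + 1) := Fin.ofNat (p + 1) i

/-- The variable `X_i`, for `i ∈ [0, p]`. -/
def x (K : Type*) [Field K] (p i : ℕ) : R K p := MvPolynomial.X (idx p i)

/-- The map `η : R → K[T]`, `X_i ↦ T^{m_i}`. -/
def eta (K : Type*) [Field K] (p a b d : ℕ) : R K p →ₐ[K] Polynomial K :=
  MvPolynomial.aeval (fun i : Fin (p + 1) => (Polynomial.X : Polynomial K) ^ m p a b d i)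

/-- The defining ideal `℘ = ker η` of the monomial curve. -/
def wp (K : Type*) [Field K] (p a b d : ℕ) : Ideal (R K p) := RingHom.ker (eta K p a b d)

/-- `ε(i, j)`. -/
def eps (p i j : ℕ) : ℕ := if i + j < p then i + j else p

/-- `τ(i, j)`. -/
def tau (p i j : ℕ) : ℕ := if i + j < p then 0 else p

/-- `φ(i, j) = X_i X_j - X_{ε(i,j)} X_{i+j-ε(i,j)}`. -/
def phi (K : Type*) [Field K] (p i j : ℕ) : R K p :=
  x K p i * x K p j - x K p (eps p i j) * x K p (i + j - eps p i j)

/-- `ψ(b, i) = X_{b+i} X_p^a - X_i X_0^{a+d}`. -/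
def psi (K : Type*) [Field K] (p a b d i : ℕ) : R K p :=
  x K p (b + i) * x K p p ^ a - x K p i * x K p 0 ^ (a + d)

/-! ### The free module and the first syzygy module -/

/-- The symbols `Ψ(b, i)`, `i ∈ [0, p - b]`, and `Φ(i, j)`, `1 ≤ i ≤ j ≤ p - 1`. -/
inductive Gen (p b : ℕ) : Type
  | psi (i : ℕ) (h : b + i ≤ p) : Gen p b
  | phi (i j : ℕ) (hi : 1 ≤ i) (hij : i ≤ j) (hj : j < p) : Gen p b

/-- The binomial `ψ(b, i)` or `φ(i, j)` that belongs to a symbol. -/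
def Gen.binomial (K : Type*) [Field K] (p a b d : ℕ) : Gen p b → R K p
  | .psi i _ => MonCurve.psi K p a b d i
  | .phi i j _ _ _ => MonCurve.phi K p i j

/-- The free `R`-module `M` on the symbols `Ψ(b, i)` and `Φ(i, j)`. -/
abbrev M (K : Type*) [Field K] (p b : ℕ) : Type _ := Gen p b →₀ R K p

/-- The `R`-linear map `M → R[t]`, `Ψ(b, i) ↦ ψ(b, i) t`, `Φ(i, j) ↦ φ(i, j) t`. -/
def relMap (K : Type*) [Field K] (p a b d : ℕ) : M K p b →ₗ[R K p] Polynomial (R K p) :=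
  Finsupp.linearCombination (R K p)
    (fun e : Gen p b => Polynomial.monomial 1 (e.binomial K p a b d))

/-- The first syzygy module `N`. -/
def N (K : Type*) [Field K] (p a b d : ℕ) : Submodule (R K p) (M K p b) :=
  LinearMap.ker (relMap K p a b d)

/-! ### The monomial orders -/

/-- The weight `ω(X^α) = ∑ α_i m_i`. -/
def weight (p a b d : ℕ) (α : Fin (p + 1) →₀ ℕ) : ℕ := ∑ i, α i * m p a b d i

/-- The position of `α_i` in the tuple `(α_1, …, α_p, α_0)`. -/
def slot {p : ℕ} (i : Fin (p + 1)) : ℕ := if i = 0 then p + 1 else i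

/-- `X^α >_R X^β`: the weight is larger, or the weights agree and the right-most non-zero entry
of `(α_1 - β_1, …, α_p - β_p, α_0 - β_0)` is negative. -/
def gtR (p a b d : ℕ) (α β : Fin (p + 1) →₀ ℕ) : Prop :=
  weight p a b d β < weight p a b d α ∨
    (weight p a b d α = weight p a b d β ∧
      ∃ i, α i < β i ∧ ∀ j, slot i < slot j → α j = β j)

/-- The exponent of `ϖ(e)`: `ϖ(Ψ(b, i)) = X_p^a X_{b+i}` and `ϖ(Φ(i, j)) = X_i X_j`. -/
def Gen.exponent (p a b : ℕ) : Gen p b → (Fin (p + 1) →₀ ℕ)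
  | .psi i _ => Finsupp.single (idx p p) a + Finsupp.single (idx p (b + i)) 1
  | .phi i j _ _ _ => Finsupp.single (idx p i) 1 + Finsupp.single (idx p j) 1

/-- The exponent of `ϖ(X^α e) = X^α ϖ(e)`. -/
def varpi (p a b : ℕ) (u : (Fin (p + 1) →₀ ℕ) × Gen p b) : Fin (p + 1) →₀ ℕ :=
  u.1 + u.2.exponent p a b

/-- The order on the symbols that breaks ties: `Ψ(b, i) > Ψ(b, j)` if `i < j`;
`Ψ(b, i) > Φ(l, j)`; `Φ(i, j) > Φ(i', j')` if `j > j'`, or `j = j'` and `i > i'`. -/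
def Gen.gt {p b : ℕ} : Gen p b → Gen p b → Prop
  | .psi i _, .psi j _ => i < j
  | .psi _ _, .phi _ _ _ _ _ => True
  | .phi _ _ _ _ _, .psi _ _ => False
  | .phi i j _ _ _, .phi i' j' _ _ _ => j' < j ∨ (j = j' ∧ i' < i)

/-- The order `>_M` on the monomials of `M`. -/
def gtM (p a b d : ℕ) (u v : (Fin (p + 1) →₀ ℕ) × Gen p b) : Prop :=
  gtR p a b d (varpi p a b u) (varpi p a b v) ∨
    (varpi p a b u = varpi p a b v ∧ u.2.gt v.2)

/-! ### The explicit syzygies -/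

/-- `Ψ(b, i)` as an element of `M`; only used for `b + i ≤ p`. -/
def Psi (K : Type*) [Field K] (p b i : ℕ) : M K p b :=
  if h : b + i ≤ p then Finsupp.single (Gen.psi i h) 1 else 0

/-- `Φ(i, j)` as an element of `M`, with `Φ(i, j) = Φ(j, i)`, and `Φ(i, j) = 0` unless both
indices lie in `[1, p - 1]`. -/
def Phi (K : Type*) [Field K] (p b i j : ℕ) : M K p b :=
  if h : 1 ≤ min i j ∧ max i j < p then
    Finsupp.single (Gen.phi (min i j) (max i j) h.1 min_le_max h.2) 1
  else 0

/-- `A(i; b, j)`. In the last term `b + i + j - p` is read as `0` when it is negative; then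
`Φ(0, p - b) = 0`, in accordance with the convention. -/
def A (K : Type*) [Field K] (p a b d i j : ℕ) : M K p b :=
  x K p i • Psi K p b j
    - x K p (b + i + j - eps p i (b + j)) • Psi K p b (eps p i (b + j) - b)
    - x K p p ^ a • Phi K p b i (b + j)
    + x K p 0 ^ (a + d) • (Phi K p b i j - Phi K p b (b + i + j - p) (p - b))

/-- `B(i, j)`. -/
def B (K : Type*) [Field K] (p a b d i j : ℕ) : M K p b :=
  (x K p i * x K p j) • Psi K p b (p - b)
    - (x K p (eps p i j) * x K p (i + j - eps p i j)) • Psi K p b (p - b)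
    - psi K p a b d (p - b) • Phi K p b i j

/-- `L(l; i, j)`. -/
def L (K : Type*) [Field K] (p b l i j : ℕ) : M K p b :=
  x K p l • Phi K p b i j
    - x K p j • Phi K p b i l
    + x K p (tau p i j) • Phi K p b (i + j - tau p i j) l
    - x K p (tau p i l) • Phi K p b (i + l - tau p i l) j

/-- The set `Ĝ`. -/
def Ghat (K : Type*) [Field K] (p a b d : ℕ) : Set (M K p b) :=
  {g | ∃ i j, 1 ≤ i ∧ i ≤ p ∧ b + j < p ∧ g = A K p a b d i j} ∪
  {g | ∃ i j, 1 ≤ i ∧ i < p ∧ 1 ≤ j ∧ j < p ∧ g = B K p a b d i j} ∪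
  {g | ∃ l i j, 1 ≤ l ∧ l < j ∧ 1 ≤ i ∧ i ≤ j ∧ j < p ∧ g = L K p b l i j}

end MonCurve

end

/-! Both halves follow one scheme, which avoids S-pairs. Call a monomial standard if no leading
monomial of the given elements divides it. Rewriting by these elements reduces everything to
standard monomials (`span_le_sup_span_standard`), while the linear map whose kernel is sought is
injective on the span of the standard monomials. Hence the given elements account for the whole
kernel.

For `℘` the map is `η`. A standard monomial is X_0^n X_p^k, possibly times one middle variable X_i,
with kp + i < m_0 (put i = 0 if there is none). Its weight is (degree)·m_0 + (kp + i)d. Since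
gcd(m_0, d) = 1, the residue mod m_0 determines kp + i, hence k and i, and then the degree
determines n. So `η` sends distinct standard monomials to distinct powers of T.

For `N` the map is `evalBinomial`, which replaces each symbol by its binomial. The image of X^α e
has leading monomial ϖ(X^α e). The leading monomials of A, B, L are X_i Ψ(b,j), X_i X_j Ψ(b,p-b) and
X_l Φ(i,j), and `ϖ` is injective on the monomials that avoid them (`varpi_injOn_standardM`), so
their images are linearly independent. If an element of `N` had a standard leading monomial u,
reducing its tail would give a nontrivial linear relation between the image of u and images of
smaller standard monomials. -/

noncomputable section

namespace MonCurve

open MvPolynomial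

/-! ### Relations with finite down-sets, triangular families, reduction -/

section Abstract

/-- A strict order in which every element has finitely many predecessors is well-founded. -/
theorem wellFounded_of_finite_setOf {U : Type*} {r : U → U → Prop} (irr : ∀ u, ¬ r u u)
    (tr : ∀ u v w, r u v → r v w → r u w) (fin : ∀ u, {v | r v u}.Finite) : WellFounded r := by
  -- The number of predecessors is a rank: transitivity gives inclusion of the predecessor sets, and
  -- `v` itself makes it strict.
  refine Subrelation.wf (r := InvImage (· < ·) fun u => {v | r v u}.ncard) ?_
    (InvImage.wf _ wellFounded_lt)
  intro v u h
  refine Set.ncard_lt_ncard ⟨fun w hw => tr _ _ _ hw h, fun hsub => irr v (hsub h)⟩ (fin u)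

variable {K U V : Type*} [Field K] [AddCommGroup V] [Module K V]

/-- If every non-standard `e v` is congruent modulo `N` to a combination of smaller `e w`, then
every combination of the `e v` with `v` in a down-set is congruent to one of standard ones. -/
theorem span_le_sup_span_standard {lt : U → U → Prop} (wf : WellFounded lt) (e : U → V)
    (N : Submodule K V) (S : Set U)
    (red : ∀ v, v ∉ S → e v ∈ N ⊔ Submodule.span K (e '' {w | lt w v}))
    (D : Set U) (hD : ∀ v ∈ D, ∀ w, lt w v → w ∈ D) :
    Submodule.span K (e '' D) ≤ N ⊔ Submodule.span K (e '' (S ∩ D)) := by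
  rw [Submodule.span_le]
  rintro _ ⟨v, hv, rfl⟩
  induction v using wf.induction with
  | _ v ih =>
    by_cases hS : v ∈ S
    · exact Submodule.mem_sup_right (Submodule.subset_span ⟨v, ⟨hS, hv⟩, rfl⟩)
    · refine (sup_le le_sup_left ?_ : N ⊔ Submodule.span K (e '' {w | lt w v}) ≤ _) (red v hS)
      rw [Submodule.span_le]
      rintro _ ⟨w, hw, rfl⟩
      exact ih w hw (hD v hv w hw)

/-- A family of polynomials which is triangular with respect to a strict order on the exponents
is linearly independent. -/
theorem linearIndepOn_of_triangular {σ : Type*} {gt : (σ →₀ ℕ) → (σ →₀ ℕ) → Prop}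
    (irr : ∀ α, ¬ gt α α) (tr : ∀ α β γ, gt α β → gt β γ → gt α γ)
    (T : U → MvPolynomial σ K) (ρ : U → σ →₀ ℕ) (S : Set U)
    (lead : ∀ u ∈ S, (T u).coeff (ρ u) ≠ 0)
    (low : ∀ u ∈ S, ∀ w ∈ S, w ≠ u → (T w).coeff (ρ u) ≠ 0 → gt (ρ w) (ρ u)) :
    LinearIndepOn K T S := by
  rw [linearIndepOn_iff]
  intro c hc h0
  by_contra hne
  have hwf : WellFounded fun w u : c.support => gt (ρ w) (ρ u) :=
    @Finite.wellFounded_of_trans_of_irrefl _ _ _ ⟨fun _ _ _ h h' => tr _ _ _ h h'⟩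
      ⟨fun _ => irr _⟩
  obtain ⟨u, hu⟩ := Finsupp.support_nonempty_iff.2 hne
  -- Here `ρ u` is maximal over the support of `c`, so no other term can contribute to the
  -- coefficient at `ρ u`.
  obtain ⟨⟨u, hu⟩, -, hmin⟩ := hwf.has_min Set.univ ⟨⟨u, hu⟩, trivial⟩
  have hS : ∀ w ∈ c.support, w ∈ S := fun w hw => (Finsupp.mem_supported K c).1 hc hw
  have h1 := congrArg (coeff (ρ u)) h0
  rw [Finsupp.linearCombination_apply, Finsupp.sum, coeff_sum, coeff_zero,
    Finset.sum_eq_single_of_mem u hu] at h1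
  · rw [coeff_smul, smul_eq_mul] at h1
    exact mul_ne_zero (Finsupp.mem_support_iff.1 hu) (lead u (hS u hu)) h1
  · intro w hw hwu
    rw [coeff_smul, smul_eq_mul]
    by_contra hz
    exact hmin ⟨w, hw⟩ trivial (low u (hS u hu) w (hS w hw) hwu (right_ne_zero_of_mul hz))

end Abstract

/-! ### Exponents -/

section Order

variable {p a b d : ℕ}

/-- The exponent of the variable `X_i`. -/
def ex (p i : ℕ) : Fin (p + 1) →₀ ℕ := Finsupp.single (idx p i) 1

theorem idx_val {i : ℕ} (h : i ≤ p) : (idx p i).val = i := by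
  simp [idx, Fin.ofNat, Nat.mod_eq_of_lt (Nat.lt_succ_of_le h)]

theorem idx_eq_iff {i j : ℕ} (hi : i ≤ p) (hj : j ≤ p) : idx p i = idx p j ↔ i = j := by
  rw [Fin.ext_iff, idx_val hi, idx_val hj]

theorem exists_idx (i : Fin (p + 1)) : ∃ j ≤ p, i = idx p j :=
  ⟨i, Nat.le_of_lt_succ i.2, Fin.ext (idx_val (Nat.le_of_lt_succ i.2)).symm⟩

theorem ex_apply {i j : ℕ} (hi : i ≤ p) (hj : j ≤ p) :
    ex p i (idx p j) = if i = j then 1 else 0 := by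
  simp [ex, Finsupp.single_apply, idx_eq_iff hi hj]

theorem exponent_ext {α β : Fin (p + 1) →₀ ℕ}
    (h : ∀ i ≤ p, α (idx p i) = β (idx p i)) : α = β := by
  ext i
  obtain ⟨j, hj, rfl⟩ := exists_idx i
  exact h j hj

theorem exponent_le {α β : Fin (p + 1) →₀ ℕ}
    (h : ∀ i ≤ p, α (idx p i) ≤ β (idx p i)) : α ≤ β := by
  intro i
  obtain ⟨j, hj, rfl⟩ := exists_idx i
  exact h j hj

theorem ex_le {α : Fin (p + 1) →₀ ℕ} {i : ℕ} (h : 1 ≤ α (idx p i)) : ex p i ≤ α := by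
  rwa [ex, Finsupp.single_le_iff]

theorem weight_add (α β : Fin (p + 1) →₀ ℕ) :
    weight p a b d (α + β) = weight p a b d α + weight p a b d β := by
  simp [weight, add_mul, Finset.sum_add_distrib]

theorem weight_smul (n : ℕ) (α : Fin (p + 1) →₀ ℕ) :
    weight p a b d (n • α) = n * weight p a b d α := by
  simp [weight, Finset.mul_sum, mul_assoc]

theorem weight_zero : weight p a b d 0 = 0 := by simp [weight]

theorem weight_ex {i : ℕ} (hi : i ≤ p) : weight p a b d (ex p i) = m p a b d i := by
  rw [weight, Finset.sum_eq_single_of_mem (idx p i) (Finset.mem_univ _)]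
  · simp [ex, idx_val hi]
  · intro j _ hj
    simp [ex, hj.symm]

theorem slot_injective : Function.Injective (slot (p := p)) := by
  intro i j h
  have := i.2
  have := j.2
  unfold slot at h
  ext
  split_ifs at h with h1 h2 h2
  · rw [h1, h2]
  · omega
  · omega
  · exact h

theorem gtR_irrefl (α : Fin (p + 1) →₀ ℕ) : ¬ gtR p a b d α α := by
  rintro (h | ⟨-, i, h, -⟩) <;> exact lt_irrefl _ h

theorem gtR_trans (α β γ : Fin (p + 1) →₀ ℕ) (h : gtR p a b d α β) (h' : gtR p a b d β γ) :
    gtR p a b d α γ := by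
  rcases h with h | ⟨h, i, hi, hi'⟩ <;> rcases h' with h' | ⟨h', j, hj, hj'⟩
  · exact .inl (h'.trans h)
  · exact .inl (h' ▸ h)
  · exact .inl (h ▸ h')
  · refine .inr ⟨h.trans h', ?_⟩
    rcases lt_trichotomy (slot i) (slot j) with hs | hs | hs
    · exact ⟨j, hi' j hs ▸ hj, fun k hk => (hi' k (hs.trans hk)).trans (hj' k hk)⟩
    · obtain rfl := slot_injective hs
      exact ⟨i, hi.trans hj, fun k hk => (hi' k hk).trans (hj' k hk)⟩
    · exact ⟨i, hj' i hs ▸ hi, fun k hk => (hi' k hk).trans (hj' k (hs.trans hk))⟩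

theorem gtR_total (α β : Fin (p + 1) →₀ ℕ) : gtR p a b d α β ∨ α = β ∨ gtR p a b d β α := by
  rcases lt_trichotomy (weight p a b d α) (weight p a b d β) with h | h | h
  · exact .inr (.inr (.inl h))
  · by_cases hne : α = β
    · exact .inr (.inl hne)
    · obtain ⟨k, hk⟩ := DFunLike.ne_iff.1 hne
      obtain ⟨i, hi, hmax⟩ := Finset.exists_max_image
        (Finset.univ.filter fun i => α i ≠ β i) slot ⟨k, by simpa using hk⟩
      have hmax' : ∀ j, slot i < slot j → α j = β j := by
        intro j hj
        by_contra hj'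
        exact (hmax j (by simpa using hj')).not_gt hj
      rcases lt_or_gt_of_ne (Finset.mem_filter.1 hi).2 with hlt | hlt
      · exact .inl (.inr ⟨h, i, hlt, hmax'⟩)
      · exact .inr (.inr (.inr ⟨h.symm, i, hlt, fun j hj => (hmax' j hj).symm⟩))
  · exact .inl (.inl h)

theorem gtR_add_left (γ : Fin (p + 1) →₀ ℕ) {α β : Fin (p + 1) →₀ ℕ} (h : gtR p a b d α β) :
    gtR p a b d (γ + α) (γ + β) := by
  rcases h with h | ⟨h, i, hi, hi'⟩
  · exact .inl (by simpa [weight_add] using h)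
  · exact .inr ⟨by simp [weight_add, h], i, by simpa using hi, fun j hj => by simp [hi' j hj]⟩

/-- Two monomials of equal weight are compared by the exponents of `X_0` and `X_p`, if these
suffice to decide. -/
theorem gtR_of_le {α β : Fin (p + 1) →₀ ℕ} (hw : weight p a b d α = weight p a b d β)
    (h0 : α (idx p 0) ≤ β (idx p 0))
    (h : α (idx p 0) < β (idx p 0) ∨ α (idx p p) < β (idx p p)) : gtR p a b d α β := by
  have hz : idx p 0 = 0 := Fin.ext (idx_val (Nat.zero_le p))
  refine .inr ⟨hw, ?_⟩
  -- X_0 sits in the last slot and X_p in the one before it, so beyond X_p only X_0 remains to be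
  -- checked.
  by_cases hlt : α (idx p 0) < β (idx p 0)
  · refine ⟨idx p 0, hlt, fun j hj => ?_⟩
    have := j.2
    unfold slot at hj
    split_ifs at hj with h1 h2 <;> omega
  · have h00 := le_antisymm h0 (not_lt.1 hlt)
    refine ⟨idx p p, h.resolve_left hlt, fun j hj => ?_⟩
    have h3 := j.2
    have h4 : (idx p p).val = p := idx_val le_rfl
    unfold slot at hj
    split_ifs at hj with h1 h2 h2
    · omega
    · omega
    · rw [h2, ← hz, h00]
    · omega

/-- Every m_i is at least 1, so a bound on the weight bounds each exponent. This is where all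
well-foundedness comes from; the tie-break plays no part in it. -/
theorem finite_weight_le (hb : 1 ≤ b) (n : ℕ) : {α | weight p a b d α ≤ n}.Finite := by
  refine (Set.finite_Iic (Finsupp.equivFunOnFinite.symm fun _ : Fin (p + 1) => n)).subset ?_
  intro α hα i
  have h1 : α i * m p a b d i ≤ weight p a b d α :=
    Finset.single_le_sum (f := fun i : Fin (p + 1) => α i * m p a b d i)
      (fun _ _ => Nat.zero_le _) (Finset.mem_univ i)
  have h2 : 1 ≤ m p a b d i := by unfold m; omega
  simpa using (Nat.le_mul_of_pos_right (α i) h2).trans (h1.trans hα)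

theorem weight_le_of_gtR {α β : Fin (p + 1) →₀ ℕ} (h : gtR p a b d α β) :
    weight p a b d β ≤ weight p a b d α := by
  rcases h with h | ⟨h, -⟩
  exacts [h.le, h.ge]

theorem gtR_wf (hb : 1 ≤ b) : WellFounded fun α β => gtR p a b d β α :=
  wellFounded_of_finite_setOf gtR_irrefl (fun _ _ _ h h' => gtR_trans _ _ _ h' h)
    fun α => (finite_weight_le hb (weight p a b d α)).subset fun _ h => weight_le_of_gtR h

/-! ### The order on the free module -/

theorem Gen.gt_irrefl (e : Gen p b) : ¬ e.gt e := by
  cases e <;> simp [Gen.gt]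

theorem Gen.gt_trans (e f g : Gen p b) (h : e.gt f) (h' : f.gt g) : e.gt g := by
  cases e <;> cases f <;> cases g <;> simp only [Gen.gt] at h h' ⊢ <;> omega

theorem Gen.gt_total (e f : Gen p b) : e.gt f ∨ e = f ∨ f.gt e := by
  cases e <;> cases f <;>
    simp only [Gen.gt, Gen.psi.injEq, Gen.phi.injEq, reduceCtorEq, true_or, or_true] <;> omega

instance : Finite (Gen p b) := by
  refine Finite.of_injective (β := Bool × Fin (p + 1) × Fin (p + 1)) (fun e => match e with
    | .psi i h => (false, ⟨i, by omega⟩, 0)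
    | .phi i j _ _ _ => (true, ⟨i, by omega⟩, ⟨j, by omega⟩)) ?_
  intro e f h
  cases e <;> cases f <;> simp_all

theorem gtM_irrefl (u : (Fin (p + 1) →₀ ℕ) × Gen p b) : ¬ gtM p a b d u u := by
  rintro (h | ⟨-, h⟩)
  exacts [gtR_irrefl _ h, Gen.gt_irrefl _ h]

theorem gtM_trans (u v w : (Fin (p + 1) →₀ ℕ) × Gen p b) (huv : gtM p a b d u v)
    (hvw : gtM p a b d v w) : gtM p a b d u w := by
  rcases huv with h | ⟨h, h1⟩ <;> rcases hvw with h' | ⟨h', h2⟩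
  · exact .inl (gtR_trans _ _ _ h h')
  · exact .inl (h' ▸ h)
  · exact .inl (h ▸ h')
  · exact .inr ⟨h.trans h', Gen.gt_trans _ _ _ h1 h2⟩

theorem gtM_wf (hb : 1 ≤ b) : WellFounded fun u v => gtM p a b d v u := by
  refine wellFounded_of_finite_setOf gtM_irrefl (fun _ _ _ h h' => gtM_trans _ _ _ h' h)
    fun u => ?_
  refine ((finite_weight_le (p := p) (a := a) (d := d) hb (weight p a b d (varpi p a b u))).prod
    (Set.finite_univ (α := Gen p b))).subset fun v hv => ⟨?_, trivial⟩
  have h1 : weight p a b d (varpi p a b v) ≤ weight p a b d (varpi p a b u) := by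
    rcases hv with h | ⟨h, -⟩
    exacts [weight_le_of_gtR h, h ▸ le_rfl]
  rw [varpi, weight_add] at h1
  exact (Nat.le_add_right _ _).trans h1

theorem varpi_add (γ : Fin (p + 1) →₀ ℕ) (u : (Fin (p + 1) →₀ ℕ) × Gen p b) :
    varpi p a b (γ + u.1, u.2) = γ + varpi p a b u := add_assoc _ _ _

theorem isMonomialOrder_gtM (hb : 1 ≤ b) : IsMonomialOrder (gtM p a b d) where
  irrefl := gtM_irrefl
  trans := gtM_trans
  total u v := by
    rcases gtR_total (a := a) (b := b) (d := d) (varpi p a b u) (varpi p a b v) with h | h | h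
    · exact .inl (.inl h)
    · rcases Gen.gt_total u.2 v.2 with h' | h' | h'
      · exact .inl (.inr ⟨h, h'⟩)
      · refine .inr (.inl (Prod.ext ?_ h'))
        rw [varpi, varpi, h'] at h
        exact add_right_cancel h
      · exact .inr (.inr (.inr ⟨h.symm, h'⟩))
    · exact .inr (.inr (.inl h))
  mul_left γ u v := by
    rintro (h | ⟨h, h'⟩)
    · exact .inl (by simpa only [varpi_add] using gtR_add_left γ h)
    · exact .inr ⟨by simp only [varpi_add, h], h'⟩
  wf := gtM_wf hb

end Order

/-! ### The binomials and the defining ideal -/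

section Ideal

variable {K : Type*} [Field K] {p a b d : ℕ}

/-- The exponent of the smaller monomial of a binomial. -/
def Gen.lower (p a b d : ℕ) : Gen p b → (Fin (p + 1) →₀ ℕ)
  | .psi i _ => ex p i + (a + d) • ex p 0
  | .phi i j _ _ _ => ex p (eps p i j) + ex p (i + j - eps p i j)

theorem x_eq (i : ℕ) : x K p i = monomial (ex p i) 1 := rfl

theorem single_idx (i n : ℕ) : Finsupp.single (idx p i) n = n • ex p i := by
  simp [ex]

theorem Gen.exponent_psi (i : ℕ) (h : b + i ≤ p) :
    (Gen.psi i h).exponent p a b = a • ex p p + ex p (b + i) := by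
  simp only [Gen.exponent, single_idx, one_smul]

theorem Gen.exponent_phi (i j : ℕ) (hi : 1 ≤ i) (hij : i ≤ j) (hj : j < p) :
    (Gen.phi (b := b) i j hi hij hj).exponent p a b = ex p i + ex p j := rfl

theorem Gen.binomial_eq (e : Gen p b) : e.binomial K p a b d =
    monomial (e.exponent p a b) 1 - monomial (e.lower p a b d) 1 := by
  cases e with
  | psi i h =>
    simp only [Gen.binomial, MonCurve.psi, x_eq, monomial_pow, monomial_mul, one_pow, mul_one,
      Gen.exponent_psi, Gen.lower, add_comm (a • ex p p)]
  | phi i j hi hij hj =>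
    simp only [Gen.binomial, MonCurve.phi, x_eq, monomial_mul, mul_one, Gen.exponent_phi, Gen.lower]

theorem eps_le (i j : ℕ) : eps p i j ≤ p := by
  unfold eps; split_ifs <;> omega

theorem sub_eps_le {i j : ℕ} (hi : i ≤ p) (hj : j ≤ p) : i + j - eps p i j ≤ p := by
  unfold eps; split_ifs <;> omega

theorem eps_le_add (i j : ℕ) : eps p i j ≤ i + j := by
  unfold eps; split_ifs <;> omega

/-- The weight of `X_i X_j` depends only on `i + j`. -/
theorem m_add_m_congr {i j k l : ℕ} (h : i + j = k + l) :
    m p a b d i + m p a b d j = m p a b d k + m p a b d l := by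
  have h' : i * d + j * d = k * d + l * d := by rw [← add_mul, ← add_mul, h]
  unfold m
  omega

/-- For Ψ this is the identity a·pd + b·d = d·m_0, which explains the exponent a + d of X_0; for Φ
the two index sums agree. -/
theorem Gen.weight_eq (e : Gen p b) :
    weight p a b d (e.exponent p a b) = weight p a b d (e.lower p a b d) := by
  cases e with
  | psi i h =>
    rw [Gen.exponent_psi, Gen.lower, weight_add, weight_add, weight_smul, weight_smul,
      weight_ex le_rfl, weight_ex h, weight_ex (by omega), weight_ex (Nat.zero_le _)]
    unfold m
    ring
  | phi i j hi hij hj =>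
    rw [Gen.exponent_phi, Gen.lower, weight_add, weight_add, weight_ex (by omega),
      weight_ex (by omega), weight_ex (eps_le i j), weight_ex (sub_eps_le (by omega) (by omega))]
    have := eps_le_add (p := p) i j
    exact m_add_m_congr (by omega)

/-- The weights agree, so X_0 and X_p decide. The larger monomial never contains X_0. For Ψ the
smaller one has X_0^(a+d); for Φ it has X_0 or X_p, while X_i X_j has neither. -/
theorem Gen.gtR_lower (ha : 1 ≤ a) (hb : 1 ≤ b) (e : Gen p b) :
    gtR p a b d (e.exponent p a b) (e.lower p a b d) := by
  refine gtR_of_le e.weight_eq ?_ ?_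
  all_goals
    cases e with
    | psi i h =>
      simp only [Gen.exponent_psi, Gen.lower, Finsupp.add_apply, Finsupp.smul_apply, smul_eq_mul]
      rw [ex_apply le_rfl (Nat.zero_le p), ex_apply h (Nat.zero_le p),
        ex_apply (by omega) (Nat.zero_le p), ex_apply (Nat.zero_le p) (Nat.zero_le p)]
      rw [if_neg (by omega), if_neg (by omega), if_pos rfl]
      omega
    | phi i j hi hij hj =>
      simp only [Gen.exponent_phi, Gen.lower, Finsupp.add_apply]
      have h1 := eps_le (p := p) i j
      have h2 := sub_eps_le (p := p) (i := i) (j := j) (by omega) (by omega)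
      have h3 := eps_le_add (p := p) i j
      rw [ex_apply (by omega) (Nat.zero_le p), ex_apply (by omega) (Nat.zero_le p),
        ex_apply h1 (Nat.zero_le p), ex_apply h2 (Nat.zero_le p)]
      try rw [ex_apply (by omega) (le_refl p), ex_apply (by omega) (le_refl p),
        ex_apply h1 (le_refl p), ex_apply h2 (le_refl p)]
      unfold eps at *
      split_ifs <;> omega

/-! ### The kernel of `η` and the standard monomials of `R` -/

theorem eta_monomial (α : Fin (p + 1) →₀ ℕ) (c : K) :
    eta K p a b d (monomial α c) = Polynomial.monomial (weight p a b d α) c := by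
  rw [eta, aeval_monomial, Finsupp.prod_fintype _ _ (fun _ => pow_zero _),
    ← Polynomial.C_mul_X_pow_eq_monomial, Polynomial.algebraMap_eq, weight,
    ← Finset.prod_pow_eq_pow_sum]
  simp only [← pow_mul, mul_comm]

theorem Gen.binomial_mem_wp (e : Gen p b) : e.binomial K p a b d ∈ wp K p a b d := by
  rw [wp, RingHom.mem_ker, Gen.binomial_eq, map_sub, eta_monomial, eta_monomial, Gen.weight_eq,
    sub_self]

/-- The exponents of the monomials which are not divisible by a leading monomial of one of the
binomials. -/
def standardR (p a b : ℕ) : Set (Fin (p + 1) →₀ ℕ) :=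
  {α | ∀ e : Gen p b, ¬ e.exponent p a b ≤ α}

/-- A standard monomial is `X_0^n X_p^k` or `X_0^n X_p^k X_i`, with `kp + i < m_0`. -/
theorem standardR_normal_form (hp : 2 ≤ p) (hb : 1 ≤ b) (hbp : b ≤ p)
    {α : Fin (p + 1) →₀ ℕ} (h : α ∈ standardR p a b) :
    ∃ n k i : ℕ, i < p ∧ k * p + i < a * p + b ∧
      α = n • ex p 0 + k • ex p p + if i = 0 then 0 else ex p i := by
  -- At most one middle variable occurs, and to the first power, since every X_i X_j is a leading
  -- monomial. The value i = 0 encodes that none occurs.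
  have main : ∃ i, i < p ∧ (∀ j, 1 ≤ j → j < p → α (idx p j) = if i = j then 1 else 0) := by
    by_cases hmid : ∃ i, 1 ≤ i ∧ i < p ∧ 1 ≤ α (idx p i)
    · obtain ⟨i, hi, hip, h1⟩ := hmid
      refine ⟨i, hip, fun j hj hjp => ?_⟩
      by_contra hc
      have hle : ex p i + ex p j ≤ α := by
        refine exponent_le fun k hk => ?_
        rw [Finsupp.add_apply, ex_apply hip.le hk, ex_apply hjp.le hk]
        split_ifs at hc ⊢ <;> subst_vars <;> omega
      rcases le_total i j with hij | hij
      · exact h (.phi i j hi hij hjp) hle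
      · exact h (.phi j i hj hij hip) ((add_comm (ex p j) (ex p i)).trans_le hle)
    · push Not at hmid
      refine ⟨0, by omega, fun j hj hjp => ?_⟩
      have := hmid j hj hjp
      rw [if_neg (by omega)]
      omega
  obtain ⟨i, hip, hi⟩ := main
  have hform : α = α (idx p 0) • ex p 0 + α (idx p p) • ex p p + if i = 0 then 0 else ex p i := by
    refine exponent_ext fun j hj => ?_
    have h0 : (if i = 0 then (0 : Fin (p + 1) →₀ ℕ) else ex p i) (idx p j) =
        if i = 0 then 0 else if i = j then 1 else 0 := by
      by_cases h1 : i = 0 <;> simp [ex_apply hip.le hj, h1]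
    simp only [Finsupp.add_apply, Finsupp.smul_apply, smul_eq_mul, h0, ex_apply (Nat.zero_le p) hj,
      ex_apply le_rfl hj]
    rcases Nat.eq_zero_or_pos j with rfl | hj0
    · rw [if_pos rfl, if_neg (by omega : ¬ p = 0)]
      split_ifs <;> omega
    · rcases hj.eq_or_lt with rfl | hjp
      · split_ifs <;> omega
      · rw [hi j hj0 hjp]
        split_ifs <;> omega
  refine ⟨_, _, i, hip, ?_, hform⟩
  -- If kp + i ≥ ap + b then k ≥ a. For k = a this forces i ≥ b, and X_p^a X_i divides the monomial;
  -- for k > a the divisor is X_p^(a+1), which comes from Ψ(b, p-b).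
  by_contra hge
  have hak : a ≤ α (idx p p) := by
    by_contra hlt
    have : (α (idx p p) + 1) * p ≤ a * p := Nat.mul_le_mul_right p (by omega)
    rw [add_mul] at this
    omega
  rcases hak.eq_or_lt with heq | hlt
  · rw [← heq] at hge
    refine h (.psi (i - b) (by omega)) ?_
    rw [Gen.exponent_psi, Nat.add_sub_cancel' (by omega)]
    refine exponent_le fun j hj => ?_
    simp only [Finsupp.add_apply, Finsupp.smul_apply, smul_eq_mul, ex_apply le_rfl hj,
      ex_apply hip.le hj]
    split_ifs with h1 h2 h2
    · omega
    · subst h1; omega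
    · subst h2; rw [hi i (by omega) hip, if_pos rfl]; omega
    · omega
  · refine h (.psi (p - b) (by omega)) ?_
    rw [Gen.exponent_psi, Nat.add_sub_cancel' (by omega)]
    refine exponent_le fun j hj => ?_
    simp only [Finsupp.add_apply, Finsupp.smul_apply, smul_eq_mul, ex_apply le_rfl hj]
    split_ifs with h1
    · subst h1; omega
    · omega

/-- Distinct standard monomials have distinct weights. -/
theorem weight_injOn_standardR (hp : 2 ≤ p) (hb : 1 ≤ b) (hbp : b ≤ p)
    (hgcd : Nat.gcd (a * p + b) d = 1) : Set.InjOn (weight p a b d) (standardR p a b) := by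
  have key : ∀ n k i : ℕ, i < p →
      weight p a b d (n • ex p 0 + k • ex p p + if i = 0 then 0 else ex p i) =
        (n + k + if i = 0 then 0 else 1) * (a * p + b) + (k * p + i) * d := by
    intro n k i hi
    rw [weight_add, weight_add, weight_smul, weight_smul, weight_ex (Nat.zero_le p),
      weight_ex le_rfl]
    split_ifs with h
    · subst h
      rw [weight_zero]
      unfold m
      ring
    · rw [weight_ex hi.le]
      unfold m
      ring
  intro α hα β hβ h
  obtain ⟨n, k, i, hi, hq, rfl⟩ := standardR_normal_form hp hb hbp hα
  obtain ⟨n', k', i', hi', hq', rfl⟩ := standardR_normal_form hp hb hbp hβ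
  simp only [key _ _ _ hi, key _ _ _ hi'] at h
  -- Modulo m_0 the degree part of the weight vanishes, and d can be cancelled.
  have hmod : (k * p + i) * d ≡ (k' * p + i') * d [MOD a * p + b] := by
    have := congrArg (· % (a * p + b)) h
    simpa [Nat.ModEq, Nat.add_mod] using this
  have hqq : k * p + i = k' * p + i' :=
    ((hmod.cancel_right_of_coprime hgcd).eq_of_lt_of_lt hq hq')
  have hii : i = i' := by
    simpa [Nat.mul_add_mod', Nat.mod_eq_of_lt hi, Nat.mod_eq_of_lt hi'] using
      congrArg (· % p) hqq
  subst hii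
  have hkk : k = k' := Nat.eq_of_mul_eq_mul_right (by omega : 0 < p) (by omega)
  subst hkk
  have := Nat.eq_of_mul_eq_mul_right (by omega : 0 < a * p + b) (Nat.add_right_cancel h)
  obtain rfl : n = n' := by omega
  rfl

theorem span_range_binomial (hp : 2 ≤ p) (ha : 1 ≤ a) (hb : 1 ≤ b) (hbp : b ≤ p)
    (hgcd : Nat.gcd (a * p + b) d = 1) :
    Ideal.span (Set.range (Gen.binomial K p a b d)) = wp K p a b d := by
  set I := Ideal.span (Set.range (Gen.binomial K p a b d)) with hI
  have hle : I ≤ wp K p a b d := by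
    rw [hI, Ideal.span_le]
    rintro _ ⟨e, rfl⟩
    exact e.binomial_mem_wp
  refine le_antisymm hle fun f hf => ?_
  let mon : (Fin (p + 1) →₀ ℕ) → R K p := fun α => monomial α 1
  have hred := span_le_sup_span_standard (K := K) (gtR_wf (p := p) (a := a) (d := d) hb) mon
    (I.restrictScalars K) (standardR p a b) (fun α hα => by
      simp only [standardR, Set.mem_ofPred_eq, not_forall, not_not] at hα
      obtain ⟨e, he⟩ := hα
      obtain ⟨γ, rfl⟩ := exists_add_of_le he
      -- One rewriting step: modulo `I` the leading monomial of the binomial may be replaced by its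
      -- smaller monomial.
      have hsplit : mon (e.exponent p a b + γ) =
          monomial γ 1 * e.binomial K p a b d + mon (γ + e.lower p a b d) := by
        simp [mon, Gen.binomial_eq, mul_sub, monomial_mul, add_comm γ]
      rw [hsplit]
      refine Submodule.add_mem_sup ?_ (Submodule.subset_span ⟨_, ?_, rfl⟩)
      · exact I.mul_mem_left _ (Ideal.subset_span ⟨e, rfl⟩)
      · rw [Set.mem_ofPred_eq, add_comm _ γ]
        exact gtR_add_left γ (e.gtR_lower ha hb)) Set.univ (fun _ _ _ _ => trivial)
  have hf' : f ∈ Submodule.span K (mon '' Set.univ) := by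
    rw [f.as_sum]
    refine Submodule.sum_mem _ fun α _ => ?_
    rw [← mul_one (coeff α f), ← smul_eq_mul, ← smul_monomial]
    exact Submodule.smul_mem _ _ (Submodule.subset_span ⟨α, trivial, rfl⟩)
  obtain ⟨g, hg, s, hs, rfl⟩ := Submodule.mem_sup.1 (hred hf')
  suffices s = 0 by simpa [this] using hg
  rw [Set.inter_univ, Finsupp.mem_span_image_iff_linearCombination] at hs
  obtain ⟨c, hc, rfl⟩ := hs
  have hker : eta K p a b d (Finsupp.linearCombination K mon c) = 0 := by
    have h1 : eta K p a b d g = 0 := hle hg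
    have h2 : eta K p a b d (g + Finsupp.linearCombination K mon c) = 0 := hf
    rwa [map_add, h1, zero_add] at h2
  have hind : LinearIndepOn K (fun α => eta K p a b d (mon α)) (standardR p a b) := by
    have h1 : LinearIndependent K fun n => Polynomial.monomial (R := K) n 1 := by
      simpa using (Polynomial.basisMonomials K).linearIndependent
    have h2 := h1.comp (fun α : standardR p a b => weight p a b d α)
      (weight_injOn_standardR hp hb hbp hgcd).injective
    simp only [mon, eta_monomial]
    exact h2
  rw [linearIndepOn_iff.1 hind c hc, map_zero]
  rw [← hker]
  exact (Finsupp.apply_linearCombination K (eta K p a b d).toLinearMap mon c).symm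

end Ideal

/-! ### Monomials of the free module -/

section Module

variable {K : Type*} [Field K] {p a b d : ℕ}

/-- The monomial `X^α e` of the free module. -/
def mono (K : Type*) [Field K] {p b : ℕ} (u : (Fin (p + 1) →₀ ℕ) × Gen p b) : M K p b :=
  Finsupp.single u.2 (monomial u.1 1)

theorem coeff_mono (u v : (Fin (p + 1) →₀ ℕ) × Gen p b) [Decidable (u = v)] :
    (mono K u v.2).coeff v.1 = if u = v then 1 else 0 := by
  classical
  obtain ⟨α, e⟩ := u
  obtain ⟨β, f⟩ := v
  by_cases h : e = f
  · subst h
    simp [mono, coeff_monomial, Prod.ext_iff]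
  · simp [mono, h]

theorem mem_span_mono (H : M K p b) (D : Set ((Fin (p + 1) →₀ ℕ) × Gen p b))
    (hD : ∀ v, (H v.2).coeff v.1 ≠ 0 → v ∈ D) : H ∈ Submodule.span K (mono K '' D) := by
  rw [← Finsupp.sum_single H]
  refine Submodule.sum_mem _ fun e _ => ?_
  rw [(H e).as_sum, ← Finsupp.singleAddHom_apply, map_sum]
  refine Submodule.sum_mem _ fun α hα => ?_
  rw [Finsupp.singleAddHom_apply, ← mul_one (coeff α (H e)), ← smul_eq_mul,
    ← smul_monomial, ← Finsupp.smul_single]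
  exact Submodule.smul_mem _ _ (Submodule.subset_span ⟨(α, e), hD _ (mem_support_iff.1 hα), rfl⟩)

/-- The combinations of the monomials which are smaller than `u`. -/
def lowerSpan (K : Type*) [Field K] (p a b d : ℕ) (u : (Fin (p + 1) →₀ ℕ) × Gen p b) :
    Submodule K (M K p b) :=
  Submodule.span K (mono K '' {w | gtM p a b d u w})

theorem gtM_of_mem_lowerSpan {u : (Fin (p + 1) →₀ ℕ) × Gen p b} {r : M K p b}
    (hr : r ∈ lowerSpan K p a b d u) (v : (Fin (p + 1) →₀ ℕ) × Gen p b)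
    (hv : (r v.2).coeff v.1 ≠ 0) : gtM p a b d u v := by
  classical
  induction hr using Submodule.span_induction with
  | mem r hr =>
    obtain ⟨w, hw, rfl⟩ := hr
    rw [coeff_mono] at hv
    rwa [← show w = v by by_contra h; simp [h] at hv]
  | zero => simp at hv
  | add r s _ _ h1 h2 =>
    by_cases hz : (r v.2).coeff v.1 = 0
    · exact h2 (by simpa [hz] using hv)
    · exact h1 hz
  | smul c r _ h1 =>
    refine h1 fun hz => hv ?_
    simp [hz]

theorem isLeadingMonomial_of_sub_mem {u : (Fin (p + 1) →₀ ℕ) × Gen p b} {g : M K p b}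
    (h : g - mono K u ∈ lowerSpan K p a b d u) : IsLeadingMonomial (gtM p a b d) g u := by
  classical
  have key : ∀ v, (g v.2).coeff v.1 =
      ((g - mono K u) v.2).coeff v.1 + if u = v then 1 else 0 := by
    intro v
    rw [← coeff_mono (K := K), ← coeff_add, ← Finsupp.add_apply, sub_add_cancel]
  refine ⟨?_, fun v hv hne => ?_⟩
  · rw [key, if_pos rfl]
    by_cases hz : ((g - mono K u) u.2).coeff u.1 = 0
    · rw [hz, zero_add]
      exact one_ne_zero
    · exact absurd (gtM_of_mem_lowerSpan h u hz) (gtM_irrefl u)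
  · rw [key, if_neg hne.symm, add_zero] at hv
    exact gtM_of_mem_lowerSpan h v hv

theorem monomial_smul_mono (γ : Fin (p + 1) →₀ ℕ) (u : (Fin (p + 1) →₀ ℕ) × Gen p b) :
    (monomial γ (1 : K) : R K p) • mono K u = mono K (γ + u.1, u.2) := by
  simp [mono, monomial_mul]

theorem monomial_smul_mem_lowerSpan (hb : 1 ≤ b) (γ : Fin (p + 1) →₀ ℕ)
    {u : (Fin (p + 1) →₀ ℕ) × Gen p b} {r : M K p b} (hr : r ∈ lowerSpan K p a b d u) :
    (monomial γ (1 : K) : R K p) • r ∈ lowerSpan K p a b d (γ + u.1, u.2) := by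
  induction hr using Submodule.span_induction with
  | mem r hr =>
    obtain ⟨w, hw, rfl⟩ := hr
    rw [monomial_smul_mono]
    exact Submodule.subset_span ⟨_, (isMonomialOrder_gtM hb).mul_left γ u w hw, rfl⟩
  | zero => rw [smul_zero]; exact zero_mem _
  | add r s _ _ h1 h2 => rw [smul_add]; exact add_mem h1 h2
  | smul c r _ h1 => rw [smul_comm]; exact Submodule.smul_mem _ c h1

theorem Psi_eq {i : ℕ} (h : b + i ≤ p) : Psi K p b i = mono K (0, .psi i h) := by
  rw [Psi, dif_pos h]; rfl

theorem Phi_eq {i j : ℕ} (hi : 1 ≤ i) (hij : i ≤ j) (hj : j < p) :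
    Phi K p b i j = mono K (0, .phi i j hi hij hj) := by
  have h1 : min i j = i := min_eq_left hij
  have h2 : max i j = j := max_eq_right hij
  rw [Phi, dif_pos (by omega)]
  simp only [h1, h2]
  rfl

/-- Symbols outside the index range are zero by convention, so the comparison is only required when
the symbol exists. -/
theorem smul_Psi_mem_lowerSpan {u : (Fin (p + 1) →₀ ℕ) × Gen p b} (γ : Fin (p + 1) →₀ ℕ) (i : ℕ)
    (H : ∀ h : b + i ≤ p, gtR p a b d (varpi p a b u) (γ + (a • ex p p + ex p (b + i))) ∨
      (varpi p a b u = γ + (a • ex p p + ex p (b + i)) ∧ u.2.gt (.psi i h))) :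
    (monomial γ (1 : K) : R K p) • Psi K p b i ∈ lowerSpan K p a b d u := by
  by_cases h : b + i ≤ p
  · rw [Psi_eq h, monomial_smul_mono, add_zero]
    refine Submodule.subset_span ⟨_, ?_, rfl⟩
    simpa only [Set.mem_ofPred_eq, gtM, varpi.eq_1 p a b (γ, _), Gen.exponent_psi] using H h
  · rw [Psi, dif_neg h, smul_zero]
    exact zero_mem _

theorem smul_Phi_mem_lowerSpan {u : (Fin (p + 1) →₀ ℕ) × Gen p b} (γ : Fin (p + 1) →₀ ℕ)
    (i j : ℕ)
    (H : ∀ (hi : 1 ≤ min i j) (hj : max i j < p),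
      gtR p a b d (varpi p a b u) (γ + (ex p i + ex p j)) ∨
      (varpi p a b u = γ + (ex p i + ex p j) ∧ u.2.gt (.phi _ _ hi min_le_max hj))) :
    (monomial γ (1 : K) : R K p) • Phi K p b i j ∈ lowerSpan K p a b d u := by
  by_cases h : 1 ≤ min i j ∧ max i j < p
  · have hex : ex p (min i j) + ex p (max i j) = ex p i + ex p j := by
      rcases le_total i j with hij | hij
      · rw [min_eq_left hij, max_eq_right hij]
      · rw [min_eq_right hij, max_eq_left hij, add_comm (ex p j)]
    have hPhi : Phi K p b i j = mono K (0, .phi _ _ h.1 min_le_max h.2) := by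
      rw [Phi, dif_pos h]; rfl
    rw [hPhi, monomial_smul_mono, add_zero]
    refine Submodule.subset_span ⟨_, ?_, rfl⟩
    simpa only [Set.mem_ofPred_eq, gtM, varpi.eq_1 p a b (γ, _), Gen.exponent_phi, hex]
      using H h.1 h.2
  · rw [Phi, dif_neg h, smul_zero]
    exact zero_mem _

/-! ### The explicit syzygies are syzygies -/

/-- The map `M → R` that sends a symbol to its binomial. -/
def evalBinomial (K : Type*) [Field K] (p a b d : ℕ) : M K p b →ₗ[R K p] R K p :=
  Finsupp.linearCombination (R K p) (Gen.binomial K p a b d)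

/-- The variable t only marks degree one, so it can be dropped. -/
theorem mem_N_iff (H : M K p b) : H ∈ N K p a b d ↔ evalBinomial K p a b d H = 0 := by
  have h : relMap K p a b d = Polynomial.monomial 1 ∘ₗ evalBinomial K p a b d := by
    ext e : 2
    simp [relMap, evalBinomial]
  rw [N, LinearMap.mem_ker, h, LinearMap.comp_apply, Polynomial.monomial_eq_zero_iff]

theorem evalBinomial_mono (u : (Fin (p + 1) →₀ ℕ) × Gen p b) :
    evalBinomial K p a b d (mono K u) =
      monomial (varpi p a b u) 1 - monomial (u.1 + u.2.lower p a b d) 1 := by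
  simp [evalBinomial, mono, Gen.binomial_eq, mul_sub, monomial_mul, varpi]

theorem evalBinomial_Psi {i : ℕ} (h : b + i ≤ p) :
    evalBinomial K p a b d (Psi K p b i) = psi K p a b d i := by
  rw [Psi, dif_pos h, evalBinomial, Finsupp.linearCombination_single, one_smul]
  rfl

theorem phi_eq_of_lt {i j : ℕ} (h : i + j < p) :
    phi K p i j = x K p i * x K p j - x K p (i + j) * x K p 0 := by
  rw [phi, eps, if_pos h, Nat.sub_self]

theorem phi_eq_of_ge {i j : ℕ} (h : p ≤ i + j) :
    phi K p i j = x K p i * x K p j - x K p p * x K p (i + j - p) := by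
  rw [phi, eps, if_neg (not_lt.2 h)]

theorem phi_comm (i j : ℕ) : phi K p i j = phi K p j i := by
  rcases lt_or_ge (i + j) p with h | h
  · rw [phi_eq_of_lt h, phi_eq_of_lt (by omega), add_comm j i]; ring
  · rw [phi_eq_of_ge h, phi_eq_of_ge (by omega), add_comm j i]; ring

theorem phi_zero {j : ℕ} (hj : j ≤ p) : phi K p 0 j = 0 := by
  rcases hj.lt_or_eq with h | rfl
  · rw [phi_eq_of_lt (by omega), zero_add]; ring
  · rw [phi_eq_of_ge (by omega), zero_add, Nat.sub_self]; ring

theorem phi_last (j : ℕ) : phi K p p j = 0 := by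
  rw [phi_eq_of_ge (by omega), Nat.add_sub_cancel_left, sub_self]

/-- The convention Φ = 0 at the indices 0 and p is consistent because φ(0, j) and φ(p, j) vanish.
Hence the boundary cases of A and L need no separate treatment. -/
theorem evalBinomial_Phi {i j : ℕ} (hi : i ≤ p) (hj : j ≤ p) :
    evalBinomial K p a b d (Phi K p b i j) = phi K p i j := by
  by_cases h : 1 ≤ min i j ∧ max i j < p
  · rw [Phi, dif_pos h, evalBinomial, Finsupp.linearCombination_single, one_smul]
    change phi K p (min i j) (max i j) = _
    rcases le_total i j with hij | hij
    · rw [min_eq_left hij, max_eq_right hij]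
    · rw [min_eq_right hij, max_eq_left hij, phi_comm]
  · rw [Phi, dif_neg h, map_zero]
    rcases (by omega : i = 0 ∨ j = 0 ∨ i = p ∨ j = p) with rfl | rfl | rfl | rfl
    · rw [phi_zero hj]
    · rw [phi_comm, phi_zero hi]
    · rw [phi_last]
    · rw [phi_comm, phi_last]

theorem A_mem_N {i j : ℕ} (hi : 1 ≤ i) (hip : i ≤ p) (hj : b + j < p) :
    A K p a b d i j ∈ N K p a b d := by
  have he : b + (eps p i (b + j) - b) ≤ p := by unfold eps; split_ifs <;> omega
  rw [mem_N_iff, A]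
  simp only [map_add, map_sub, map_smul, smul_eq_mul]
  rw [evalBinomial_Psi hj.le, evalBinomial_Psi he, evalBinomial_Phi hip hj.le,
    evalBinomial_Phi hip (by omega), evalBinomial_Phi (by omega) (by omega)]
  rcases lt_or_ge (i + (b + j)) p with h | h
  -- Here truncated subtraction gives b + i + j - p = 0, so the last Φ contributes nothing.
  · rw [eps, if_pos h, phi_eq_of_lt h, phi_eq_of_lt (by omega : i + j < p),
      show b + i + j - p = 0 by omega, phi_zero (by omega), psi, psi,
      show i + (b + j) - b = i + j by omega,
      show b + i + j - (i + (b + j)) = 0 by omega, show b + (i + j) = i + (b + j) by omega]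
    ring
  · rw [phi_eq_of_ge h, eps, if_neg (not_lt.2 h), psi, psi, show b + (p - b) = p by omega,
      show i + (b + j) - p = b + i + j - p by omega]
    rcases lt_or_ge (i + j) p with h' | h'
    · rw [phi_eq_of_lt h', phi_eq_of_lt (by omega), show b + i + j - p + (p - b) = i + j by omega]
      ring
    · rw [phi_eq_of_ge h', phi_eq_of_ge (by omega), show b + i + j - p + (p - b) = i + j by omega]
      ring

theorem B_mem_N (hbp : b ≤ p) {i j : ℕ} (hip : i < p) (hjp : j < p) :
    B K p a b d i j ∈ N K p a b d := by
  rw [mem_N_iff, B]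
  simp only [map_sub, map_smul, smul_eq_mul]
  rw [evalBinomial_Psi (by omega), evalBinomial_Phi hip.le hjp.le, phi]
  ring

/-- Since φ(i,j) = X_i X_j - X_τ X_(i+j-τ), the sum X_l φ(i,j) + X_τ φ(i+j-τ, l) rewrites X_i X_j
X_l twice. Starting from the pair (i, l) instead ends at the same monomial, and L is the difference.
-/
theorem L_mem_N {l i j : ℕ} (hlj : l < j) (hj : j < p) (hij : i ≤ j) :
    L K p b l i j ∈ N K p a b d := by
  have h1 : i + j - tau p i j ≤ p := by unfold tau; split_ifs <;> omega
  have h2 : i + l - tau p i l ≤ p := by unfold tau; split_ifs <;> omega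
  rw [mem_N_iff, L]
  simp only [map_add, map_sub, map_smul, smul_eq_mul]
  rw [evalBinomial_Phi (by omega) (by omega), evalBinomial_Phi (by omega) (by omega),
    evalBinomial_Phi h1 (by omega), evalBinomial_Phi h2 (by omega), tau, tau]
  rcases lt_or_ge (i + j) p with h | h <;> rcases lt_or_ge (i + l) p with h' | h'
  · rw [if_pos h, if_pos h', phi_eq_of_lt h, phi_eq_of_lt h', Nat.sub_zero, Nat.sub_zero]
    rcases lt_or_ge (i + j + l) p with hs | hs
    · rw [phi_eq_of_lt hs, phi_eq_of_lt (by omega), add_right_comm i l j]; ring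
    · rw [phi_eq_of_ge hs, phi_eq_of_ge (by omega), add_right_comm i l j]; ring
  · omega
  · rw [if_neg (not_lt.2 h), if_pos h', phi_eq_of_ge h, phi_eq_of_lt h', Nat.sub_zero,
      phi_eq_of_lt (by omega : i + j - p + l < p), phi_eq_of_ge (by omega : p ≤ i + l + j),
      show i + l + j - p = i + j - p + l by omega]
    ring
  · rw [if_neg (not_lt.2 h), if_neg (not_lt.2 h'), phi_eq_of_ge h, phi_eq_of_ge h']
    rcases lt_or_ge (i + j - p + l) p with hs | hs
    · rw [phi_eq_of_lt hs, phi_eq_of_lt (by omega),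
        show i + l - p + j = i + j - p + l by omega]; ring
    · rw [phi_eq_of_ge hs, phi_eq_of_ge (by omega),
        show i + l - p + j = i + j - p + l by omega]; ring

end Module

/-! ### The leading monomials of the explicit syzygies -/

section Leading

variable {K : Type*} [Field K] {p a b d : ℕ}

/-- The leading monomial X_i Ψ(b,j) ties under `ϖ` with X_p^a Φ(i, b+j), and Ψ beats Φ. The other Φ
terms carry X_0. The second Ψ term has more X_0 or more X_p, except for i = p: then it ties, and j <
p - b decides. -/
theorem A_sub_mem_lowerSpan (ha : 1 ≤ a) (hb : 1 ≤ b) {i j : ℕ} (hi : 1 ≤ i) (hip : i ≤ p)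
    (hj : b + j < p) :
    A K p a b d i j - mono K (ex p i, .psi j hj.le) ∈
      lowerSpan K p a b d (ex p i, .psi j hj.le) := by
  set u : (Fin (p + 1) →₀ ℕ) × Gen p b := (ex p i, .psi j hj.le) with hu
  have hvar : varpi p a b u = ex p i + (a • ex p p + ex p (b + j)) := by
    rw [hu, varpi, Gen.exponent_psi]
  have hlead : mono K u = (monomial (ex p i) 1 : R K p) • Psi K p b j := by
    rw [Psi_eq hj.le, monomial_smul_mono, add_zero]
  have hsplit : A K p a b d i j - mono K u =
      (monomial ((a + d) • ex p 0) 1 : R K p) • Phi K p b i j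
      - (monomial ((a + d) • ex p 0) 1 : R K p) • Phi K p b (b + i + j - p) (p - b)
      - (monomial (a • ex p p) 1 : R K p) • Phi K p b i (b + j)
      - (monomial (ex p (b + i + j - eps p i (b + j))) 1 : R K p) •
        Psi K p b (eps p i (b + j) - b) := by
    simp only [A, hlead, x_eq, monomial_pow, one_pow, smul_sub]
    abel
  rw [hsplit]
  refine sub_mem (sub_mem (sub_mem ?_ ?_) ?_) ?_
  · refine smul_Phi_mem_lowerSpan _ _ _ fun h1 h2 => .inl (gtR_of_le ?_ ?_ (.inl ?_))
    · simp (disch := omega) only [hvar, weight_add, weight_smul, weight_ex]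
      unfold m
      ring
    all_goals
      simp (disch := omega) only [hvar, Finsupp.add_apply, Finsupp.smul_apply, smul_eq_mul,
        ex_apply]
      split_ifs <;> omega
  · refine smul_Phi_mem_lowerSpan _ _ _ fun h1 h2 => .inl (gtR_of_le ?_ ?_ (.inl ?_))
    · have h3 := m_add_m_congr (p := p) (a := a) (b := b) (d := d)
        (by omega : b + i + j - p + (p - b) = i + j)
      simp (disch := omega) only [hvar, weight_add, weight_smul, weight_ex, h3]
      unfold m
      ring
    all_goals
      simp (disch := omega) only [hvar, Finsupp.add_apply, Finsupp.smul_apply, smul_eq_mul,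
        ex_apply]
      split_ifs <;> omega
  · refine smul_Phi_mem_lowerSpan _ _ _ fun h1 h2 => .inr ⟨?_, trivial⟩
    rw [hvar, add_left_comm]
  · refine smul_Psi_mem_lowerSpan _ _ fun h => ?_
    rcases lt_or_ge (i + (b + j)) p with hs | hs
    · left
      rw [eps, if_pos hs, show b + i + j - (i + (b + j)) = 0 by omega,
        show b + (i + (b + j) - b) = i + (b + j) by omega]
      refine gtR_of_le ?_ ?_ (.inl ?_)
      · have h3 := m_add_m_congr (p := p) (a := a) (b := b) (d := d)
          (by omega : i + (b + j) = 0 + (i + (b + j)))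
        simp (disch := omega) only [hvar, weight_add, weight_smul, weight_ex]
        omega
      all_goals
        simp (disch := omega) only [hvar, Finsupp.add_apply, Finsupp.smul_apply, smul_eq_mul,
          ex_apply]
        split_ifs <;> omega
    · have he : eps p i (b + j) = p := by rw [eps, if_neg (not_lt.2 hs)]
      rcases hip.lt_or_eq with hip' | hip'
      · left
        rw [he, show b + (p - b) = p by omega]
        refine gtR_of_le ?_ ?_ (.inr ?_)
        · have h3 := m_add_m_congr (p := p) (a := a) (b := b) (d := d)
            (by omega : i + (b + j) = b + i + j - p + p)
          simp (disch := omega) only [hvar, weight_add, weight_smul, weight_ex]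
          omega
        all_goals
          simp (disch := omega) only [hvar, Finsupp.add_apply, Finsupp.smul_apply, smul_eq_mul,
            ex_apply]
          split_ifs <;> omega
      · refine .inr ⟨?_, ?_⟩
        · rw [hvar, he, show b + (p - b) = p by omega, show b + i + j - p = b + j by omega, hip']
          abel
        · change j < eps p i (b + j) - b
          omega

/-- B is the Koszul relation between ψ(b, p-b) and φ(i, j). Its only tie under `ϖ` is with X_p^(a+1)
Φ(i, j), and Ψ beats Φ. -/
theorem B_sub_mem_lowerSpan (ha : 1 ≤ a) (hbp : b ≤ p) {i j : ℕ} (hi : 1 ≤ i)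
    (hip : i < p) (hj : 1 ≤ j) (hjp : j < p) (h : b + (p - b) ≤ p) :
    B K p a b d i j - mono K (ex p i + ex p j, .psi (p - b) h) ∈
      lowerSpan K p a b d (ex p i + ex p j, .psi (p - b) h) := by
  set u : (Fin (p + 1) →₀ ℕ) × Gen p b := (ex p i + ex p j, .psi (p - b) h) with hu
  have hbb : b + (p - b) = p := by omega
  have hvar : varpi p a b u = ex p i + ex p j + (a • ex p p + ex p p) := by
    rw [hu, varpi, Gen.exponent_psi, hbb]
  have hlead : mono K u = (monomial (ex p i + ex p j) 1 : R K p) • Psi K p b (p - b) := by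
    rw [Psi_eq h, monomial_smul_mono, add_zero]
  have hsplit : B K p a b d i j - mono K u =
      (monomial (ex p (p - b) + (a + d) • ex p 0) 1 : R K p) • Phi K p b i j
      - (monomial (ex p p + a • ex p p) 1 : R K p) • Phi K p b i j
      - (monomial (ex p (eps p i j) + ex p (i + j - eps p i j)) 1 : R K p) •
        Psi K p b (p - b) := by
    simp only [B, hlead, psi, hbb, x_eq, monomial_pow, one_pow, monomial_mul, mul_one, sub_smul]
    abel
  rw [hsplit]
  refine sub_mem (sub_mem ?_ ?_) ?_
  · refine smul_Phi_mem_lowerSpan _ _ _ fun h1 h2 => .inl (gtR_of_le ?_ ?_ (.inl ?_))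
    · have h3 := (Gen.psi (p - b) h).weight_eq (a := a) (d := d)
      rw [Gen.exponent_psi, Gen.lower, hbb] at h3
      simp (disch := omega) only [hvar, weight_add] at h3 ⊢
      omega
    all_goals
      simp (disch := omega) only [hvar, Finsupp.add_apply, Finsupp.smul_apply, smul_eq_mul,
        ex_apply]
      split_ifs <;> omega
  · refine smul_Phi_mem_lowerSpan _ _ _ fun h1 h2 => .inr ⟨?_, trivial⟩
    rw [hvar]
    abel
  · refine smul_Psi_mem_lowerSpan _ _ fun h' => .inl ?_
    have h1 := eps_le (p := p) i j
    have h2 := sub_eps_le (p := p) hip.le hjp.le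
    have h3 := eps_le_add (p := p) i j
    have h4 := m_add_m_congr (p := p) (a := a) (b := b) (d := d)
      (by omega : eps p i j + (i + j - eps p i j) = i + j)
    rw [hbb]
    refine gtR_of_le ?_ ?_ ?_
    · simp (disch := omega) only [hvar, weight_add, weight_smul, weight_ex, h4]
    all_goals
      simp (disch := omega) only [hvar, Finsupp.add_apply, Finsupp.smul_apply, smul_eq_mul,
        ex_apply]
      unfold eps at *
      split_ifs <;> omega

theorem ex_apply_zero {i : ℕ} (hi : 1 ≤ i) (hip : i ≤ p) : ex p i (idx p 0) = 0 := by
  rw [ex_apply hip (Nat.zero_le p), if_neg (by omega)]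

theorem ex_apply_last {i : ℕ} (hip : i < p) : ex p i (idx p p) = 0 := by
  rw [ex_apply hip.le le_rfl, if_neg hip.ne]

/-- Cubic monomials in `X_1, …, X_{p-1}` are larger than those of equal weight in `X_0, …, X_p`
that involve `X_0` or `X_p`. -/
theorem gtR_cubic {t i j k q n : ℕ} (ht : t = 0 ∨ t = p) (hi : 1 ≤ i) (hip : i < p) (hj : 1 ≤ j)
    (hjp : j < p) (hk : 1 ≤ k) (hkp : k < p) (hq : 1 ≤ q) (hqp : q < p) (hn : 1 ≤ n) (hnp : n < p)
    (hs : i + (j + k) = t + (q + n)) :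
    gtR p a b d (ex p i + (ex p j + ex p k)) (ex p t + (ex p q + ex p n)) := by
  have htp : t ≤ p := by omega
  refine gtR_of_le ?_ ?_ ?_
  · rw [weight_add, weight_add, weight_add, weight_add, weight_ex hip.le, weight_ex hjp.le,
      weight_ex hkp.le, weight_ex htp, weight_ex hqp.le, weight_ex hnp.le]
    have h := congrArg (· * d) hs
    simp only [add_mul] at h
    unfold m
    omega
  · simp only [Finsupp.add_apply, ex_apply_zero hi hip.le, ex_apply_zero hj hjp.le,
      ex_apply_zero hk hkp.le, add_zero, Nat.zero_le]
  · simp only [Finsupp.add_apply, ex_apply_zero hi hip.le, ex_apply_zero hj hjp.le,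
      ex_apply_zero hk hkp.le, ex_apply_zero hq hqp.le, ex_apply_zero hn hnp.le,
      ex_apply_last hip, ex_apply_last hjp, ex_apply_last hkp, ex_apply_last hqp,
      ex_apply_last hnp, add_zero, ex_apply htp (Nat.zero_le p), ex_apply htp le_rfl]
    rcases ht with h | h
    · simp [h]
    · simp [h]

theorem L_sub_mem_lowerSpan {l i j : ℕ} (hl : 1 ≤ l) (hlj : l < j) (hi : 1 ≤ i) (hij : i ≤ j)
    (hj : j < p) :
    L K p b l i j - mono K (ex p l, .phi i j hi hij hj) ∈
      lowerSpan K p a b d (ex p l, .phi i j hi hij hj) := by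
  set u : (Fin (p + 1) →₀ ℕ) × Gen p b := (ex p l, .phi i j hi hij hj) with hu
  have hvar : varpi p a b u = ex p l + (ex p i + ex p j) := by
    rw [hu, varpi, Gen.exponent_phi]
  have hlead : mono K u = (monomial (ex p l) 1 : R K p) • Phi K p b i j := by
    rw [Phi_eq hi hij hj, monomial_smul_mono, add_zero]
  have hsplit : L K p b l i j - mono K u =
      (monomial (ex p (tau p i j)) 1 : R K p) • Phi K p b (i + j - tau p i j) l
      - (monomial (ex p (tau p i l)) 1 : R K p) • Phi K p b (i + l - tau p i l) j
      - (monomial (ex p j) 1 : R K p) • Phi K p b i l := by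
    simp only [L, hlead, x_eq]
    abel
  -- Both τ-terms have this shape, with (k, n) = (j, l) or (l, j).
  have tail : ∀ k n, 1 ≤ k → k ≤ j → 1 ≤ n → n ≤ j → l + (i + j) = i + k + n →
      (monomial (ex p (tau p i k)) 1 : R K p) • Phi K p b (i + k - tau p i k) n ∈
        lowerSpan K p a b d u := by
    intro k n hk hkj hn hnj hs
    refine smul_Phi_mem_lowerSpan _ _ _ fun h1 h2 => .inl ?_
    have h3 : tau p i k = 0 ∨ tau p i k = p := by unfold tau; split_ifs <;> simp
    have h4 : tau p i k ≤ i + k := by unfold tau; split_ifs <;> omega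
    rw [hvar]
    exact gtR_cubic h3 hl (by omega) hi (by omega) (by omega) hj (by omega) (by omega) (by omega)
      (by omega) (by omega)
  rw [hsplit]
  refine sub_mem (sub_mem (tail j l (by omega) le_rfl hl hlj.le (by omega))
    (tail l j hl hlj.le (by omega) le_rfl (by omega))) ?_
  refine smul_Phi_mem_lowerSpan _ _ _ fun h1 h2 => .inr ⟨?_, ?_⟩
  · rw [hvar]
    abel
  -- The tie with X_j Φ(i, l): if max(i, l) = j then i = j because l < j, and the smaller index l is
  -- below i.
  · change max i l < j ∨ (j = max i l ∧ min i l < i)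
    omega

/-- The leading monomials of the elements of `Ĝ`. -/
inductive IsLead (p b : ℕ) : (Fin (p + 1) →₀ ℕ) × Gen p b → Prop
  | A (i j : ℕ) (hi : 1 ≤ i) (hip : i ≤ p) (hj : b + j < p) : IsLead p b (ex p i, .psi j hj.le)
  | B (i j : ℕ) (hi : 1 ≤ i) (hip : i < p) (hj : 1 ≤ j) (hjp : j < p) (h : b + (p - b) ≤ p) :
      IsLead p b (ex p i + ex p j, .psi (p - b) h)
  | L (l i j : ℕ) (hl : 1 ≤ l) (hlj : l < j) (hi : 1 ≤ i) (hij : i ≤ j) (hj : j < p) :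
      IsLead p b (ex p l, .phi i j hi hij hj)

theorem IsLead.exists_mem_Ghat (ha : 1 ≤ a) (hb : 1 ≤ b) (hbp : b ≤ p)
    {u : (Fin (p + 1) →₀ ℕ) × Gen p b} (hu : IsLead p b u) :
    ∃ g ∈ Ghat K p a b d, g - mono K u ∈ lowerSpan K p a b d u := by
  cases hu with
  | A i j hi hip hj =>
    exact ⟨_, .inl (.inl ⟨i, j, hi, hip, hj, rfl⟩), A_sub_mem_lowerSpan ha hb hi hip hj⟩
  | B i j hi hip hj hjp h =>
    exact ⟨_, .inl (.inr ⟨i, j, hi, hip, hj, hjp, rfl⟩),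
      B_sub_mem_lowerSpan ha hbp hi hip hj hjp h⟩
  | L l i j hl hlj hi hij hj =>
    exact ⟨_, .inr ⟨l, i, j, hl, hlj, hi, hij, hj, rfl⟩, L_sub_mem_lowerSpan hl hlj hi hij hj⟩

theorem exists_isLeadingMonomial_of_mem_Ghat (ha : 1 ≤ a) (hb : 1 ≤ b) (hbp : b ≤ p)
    {g : M K p b} (hg : g ∈ Ghat K p a b d) : ∃ u, IsLeadingMonomial (gtM p a b d) g u := by
  rcases hg with (⟨i, j, hi, hip, hj, rfl⟩ | ⟨i, j, hi, hip, hj, hjp, rfl⟩) |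
    ⟨l, i, j, hl, hlj, hi, hij, hj, rfl⟩
  · exact ⟨_, isLeadingMonomial_of_sub_mem (A_sub_mem_lowerSpan ha hb hi hip hj)⟩
  · exact ⟨_, isLeadingMonomial_of_sub_mem
      (B_sub_mem_lowerSpan ha hbp hi hip hj hjp (by omega))⟩
  · exact ⟨_, isLeadingMonomial_of_sub_mem (L_sub_mem_lowerSpan hl hlj hi hij hj)⟩

theorem Ghat_subset_N (hbp : b ≤ p) : Ghat K p a b d ⊆ (N K p a b d : Set (M K p b)) := by
  rintro g ((⟨i, j, hi, hip, hj, rfl⟩ | ⟨i, j, hi, hip, hj, hjp, rfl⟩) |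
    ⟨l, i, j, hl, hlj, hi, hij, hj, rfl⟩)
  · exact A_mem_N hi hip hj
  · exact B_mem_N hbp hip hjp
  · exact L_mem_N hlj hj hij

theorem Ghat_finite : (Ghat K p a b d).Finite := by
  have h := Set.finite_Iic p
  refine Set.Finite.union (Set.Finite.union ?_ ?_) ?_
  · refine ((h.prod h).image fun t => A K p a b d t.1 t.2).subset ?_
    rintro g ⟨i, j, hi, hip, hj, rfl⟩
    exact ⟨(i, j), ⟨hip, (by omega : j ≤ p)⟩, rfl⟩
  · refine ((h.prod h).image fun t => B K p a b d t.1 t.2).subset ?_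
    rintro g ⟨i, j, hi, hip, hj, hjp, rfl⟩
    exact ⟨(i, j), ⟨hip.le, hjp.le⟩, rfl⟩
  · refine ((h.prod (h.prod h)).image fun t => L K p b t.1 t.2.1 t.2.2).subset ?_
    rintro g ⟨l, i, j, hl, hlj, hi, hij, hj, rfl⟩
    exact ⟨(l, i, j), ⟨(by omega : l ≤ p), (by omega : i ≤ p), hj.le⟩, rfl⟩

/-! ### Standard monomials of the free module -/

/-- The monomials of `M` which are not divisible by a leading monomial of an element of `Ĝ`. -/
def standardM (p b : ℕ) : Set ((Fin (p + 1) →₀ ℕ) × Gen p b) :=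
  {u | ∀ α, IsLead p b (α, u.2) → ¬ α ≤ u.1}

/-- The leading monomials of A exclude every variable but X_0 next to Ψ(b, i) with i < p - b. -/
theorem standardM_psi {α : Fin (p + 1) →₀ ℕ} {i : ℕ} {h : b + i ≤ p}
    (hu : (α, Gen.psi i h) ∈ standardM p b) (hi : b + i < p) {k : ℕ} (hk : 1 ≤ k) (hkp : k ≤ p) :
    α (idx p k) = 0 := by
  by_contra hne
  exact hu _ (.A k i hk hkp hi) (ex_le (Nat.one_le_iff_ne_zero.2 hne))

theorem standardM_phi {α : Fin (p + 1) →₀ ℕ} {i j : ℕ} {hi : 1 ≤ i} {hij : i ≤ j} {hj : j < p}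
    (hu : (α, Gen.phi (b := b) i j hi hij hj) ∈ standardM p b) {k : ℕ} (hk : 1 ≤ k)
    (hkj : k < j) : α (idx p k) = 0 := by
  by_contra hne
  exact hu _ (.L k i j hk hkj hi hij hj) (ex_le (Nat.one_le_iff_ne_zero.2 hne))

/-- Suppose the two values of `ϖ` agree, and compare exponents of single variables. Two Ψ's differ
at X_(b+i), or at X_p if the second is Ψ(b, p-b). For Ψ against Φ with b + i < p, the left side has
too few middle variables to contain X_i' X_j'; with b + i = p, X_i' X_j' divides α, which B
excludes. For two Φ's, α has no X_k with 1 ≤ k < j, so the left side cannot supply X_i' X_j'. -/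
theorem varpi_ne_of_gt (hb : 1 ≤ b) {u v : (Fin (p + 1) →₀ ℕ) × Gen p b}
    (hu : u ∈ standardM p b) (hv : v ∈ standardM p b) (h : u.2.gt v.2) :
    varpi p a b u ≠ varpi p a b v := by
  obtain ⟨α, e⟩ := u
  obtain ⟨β, f⟩ := v
  intro heq
  have hk := fun k => DFunLike.congr_fun heq (idx p k)
  cases e with
  | psi i hi =>
    cases f with
    | psi j hj =>
      simp only [Gen.gt] at h
      simp only [varpi, Gen.exponent_psi, Finsupp.add_apply, Finsupp.smul_apply,
        smul_eq_mul] at hk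
      rcases hj.lt_or_eq with hlt | hlast
      · have h1 := hk (b + i)
        rw [standardM_psi hv hlt (by omega) (by omega)] at h1
        simp (disch := omega) only [ex_apply] at h1
        split_ifs at h1 <;> omega
      · have h1 := hk p
        rw [standardM_psi hu (by omega) (by omega) le_rfl] at h1
        simp (disch := omega) only [ex_apply] at h1
        split_ifs at h1 <;> omega
    | phi i' j' hi' hij' hj' =>
      simp only [varpi, Gen.exponent_psi, Gen.exponent_phi, Finsupp.add_apply, Finsupp.smul_apply,
        smul_eq_mul] at hk
      rcases hi.lt_or_eq with hlt | hlast
      · have h1 := hk i'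
        have h2 := hk j'
        rw [standardM_psi hu hlt (by omega) (by omega)] at h1 h2
        simp (disch := omega) only [ex_apply] at h1 h2
        split_ifs at h1 h2 <;> omega
      · obtain rfl : i = p - b := by omega
        refine hu _ (.B i' j' hi' (by omega) (by omega) hj' hi) (exponent_le fun k hkp => ?_)
        have h1 := hk k
        rw [hlast] at h1
        simp (disch := omega) only [Finsupp.add_apply, ex_apply] at h1 ⊢
        split_ifs at h1 ⊢ <;> omega
  | phi i j hi hij hj =>
    cases f with
    | psi => exact h
    | phi i' j' hi' hij' hj' =>
      simp only [Gen.gt] at h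
      simp only [varpi, Gen.exponent_phi, Finsupp.add_apply] at hk
      have h1 := hk i'
      have h2 := hk j'
      have h3 : j' < j → α (idx p j') = 0 := standardM_phi hu (by omega)
      have h4 : i' < j → α (idx p i') = 0 := standardM_phi hu hi'
      simp (disch := omega) only [ex_apply] at h1 h2
      split_ifs at h1 h2 <;> omega

theorem varpi_injOn_standardM (hb : 1 ≤ b) : Set.InjOn (varpi p a b) (standardM p b) := by
  intro u hu v hv h
  rcases Gen.gt_total u.2 v.2 with h' | h' | h'
  · exact absurd h (varpi_ne_of_gt hb hu hv h')
  · refine Prod.ext ?_ h'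
    rw [varpi, varpi, h'] at h
    exact add_right_cancel h
  · exact absurd h.symm (varpi_ne_of_gt hb hv hu h')

/-- The image of u has leading monomial ϖ(u), and these are distinct on standard monomials, so the
family is triangular. -/
theorem linearIndepOn_evalBinomial (ha : 1 ≤ a) (hb : 1 ≤ b) :
    LinearIndepOn K (fun u => evalBinomial K p a b d (mono K u)) (standardM p b) := by
  classical
  have hlow : ∀ u : (Fin (p + 1) →₀ ℕ) × Gen p b,
      gtR p a b d (varpi p a b u) (u.1 + u.2.lower p a b d) :=
    fun u => gtR_add_left _ (u.2.gtR_lower ha hb)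
  refine linearIndepOn_of_triangular (gt := gtR p a b d) gtR_irrefl gtR_trans _ (varpi p a b) _
    (fun u hu => ?_) fun u hu w hw hne hz => ?_
  · have hne : u.1 + u.2.lower p a b d ≠ varpi p a b u := fun h =>
      gtR_irrefl _ (h ▸ hlow u)
    rw [evalBinomial_mono, coeff_sub, coeff_monomial, coeff_monomial, if_pos rfl, if_neg hne]
    simp
  · have hne' : varpi p a b w ≠ varpi p a b u := fun h => hne (varpi_injOn_standardM hb hw hu h)
    rw [evalBinomial_mono, coeff_sub, coeff_monomial, coeff_monomial, if_neg hne'] at hz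
    have h : w.1 + w.2.lower p a b d = varpi p a b u := by
      by_contra h
      simp [h] at hz
    exact h ▸ hlow w

/-- The leading monomial of an element of `N` is not standard. -/
theorem notMem_standardM_of_isLeadingMonomial (ha : 1 ≤ a) (hb : 1 ≤ b) (hbp : b ≤ p)
    {H : M K p b} (hH : H ∈ N K p a b d) {u : (Fin (p + 1) →₀ ℕ) × Gen p b}
    (hu : IsLeadingMonomial (gtM p a b d) H u) : u ∉ standardM p b := by
  classical
  intro huS
  set c := (H u.2).coeff u.1 with hc
  have hrest : H - c • mono K u ∈ Submodule.span K (mono K '' {w | gtM p a b d u w}) := by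
    refine mem_span_mono _ _ fun v hv => ?_
    rw [Finsupp.sub_apply, coeff_sub, Finsupp.smul_apply, coeff_smul, coeff_mono] at hv
    by_cases huv : u = v
    · subst huv
      simp [hc] at hv
    · refine hu.2 v ?_ (Ne.symm huv)
      simpa [huv] using hv
  -- Applied to the down-set below u, so that reducing the tail never produces u again.
  have hred := span_le_sup_span_standard (K := K) (gtM_wf (p := p) (a := a) (d := d) hb) (mono K)
    ((N K p a b d).restrictScalars K) (standardM p b) (fun v hv => by
      simp only [standardM, Set.mem_ofPred_eq, not_forall, not_not] at hv
      obtain ⟨α, hα, hle⟩ := hv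
      obtain ⟨γ, hγ⟩ := exists_add_of_le hle
      obtain ⟨g, hg, hlow⟩ := hα.exists_mem_Ghat (K := K) (a := a) (d := d) ha hb hbp
      have hv : v = (γ + α, v.2) := Prod.ext (by rw [hγ, add_comm α]) rfl
      have hsplit : mono K v = (monomial γ (1 : K) : R K p) • g -
          (monomial γ (1 : K) : R K p) • (g - mono K (α, v.2)) := by
        rw [smul_sub, monomial_smul_mono, sub_sub_cancel, ← hv]
      rw [hsplit, sub_eq_add_neg]
      refine Submodule.add_mem_sup ((N K p a b d).smul_mem _ (Ghat_subset_N hbp hg)) (neg_mem ?_)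
      have := monomial_smul_mem_lowerSpan hb γ hlow
      rwa [← hv] at this) {w | gtM p a b d u w} fun v hv w hw => gtM_trans _ _ _ hv hw
  obtain ⟨n, hn, s, hs, hns⟩ := Submodule.mem_sup.1 (hred hrest)
  have hzero : c • evalBinomial K p a b d (mono K u) + evalBinomial K p a b d s = 0 := by
    have h1 : evalBinomial K p a b d n = 0 := (mem_N_iff n).1 hn
    have h2 : evalBinomial K p a b d H = 0 := (mem_N_iff H).1 hH
    rw [← sub_add_cancel H (c • mono K u), ← hns, map_add, map_add, h1, zero_add,
      LinearMap.map_smul_of_tower, add_comm] at h2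
    exact h2
  have hsT : evalBinomial K p a b d s ∈ Submodule.span K
      ((fun u => evalBinomial K p a b d (mono K u)) ''
        (standardM p b ∩ {w | gtM p a b d u w})) := by
    have := Submodule.mem_map_of_mem (f := (evalBinomial K p a b d).restrictScalars K) hs
    rwa [Submodule.map_span, Set.image_image] at this
  have huT : evalBinomial K p a b d (mono K u) ∈ Submodule.span K
      ((fun u => evalBinomial K p a b d (mono K u)) ''
        (standardM p b ∩ {w | gtM p a b d u w})) := by
    rw [← inv_smul_smul₀ hu.1 (evalBinomial K p a b d (mono K u)), ← hc,
      eq_neg_of_add_eq_zero_left hzero]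
    exact Submodule.smul_mem _ _ (neg_mem hsT)
  have hind := linearIndepOn_evalBinomial (K := K) (p := p) (d := d) ha hb
  -- By independence, u would have to be one of the monomials strictly below u.
  refine ((hind.mono Set.inter_subset_left).mem_span_iff.1 huT ?_).2 |> gtM_irrefl u
  exact hind.mono (Set.insert_subset huS Set.inter_subset_left)

theorem isGroebnerBasis_Ghat (ha : 1 ≤ a) (hb : 1 ≤ b) (hbp : b ≤ p) :
    IsGroebnerBasis (gtM p a b d) (N K p a b d) (Ghat K p a b d) where
  order := isMonomialOrder_gtM hb
  finite := Ghat_finite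
  subset := Ghat_subset_N hbp
  ne_zero g hg := by
    rintro rfl
    obtain ⟨u, hu⟩ := exists_isLeadingMonomial_of_mem_Ghat ha hb hbp hg
    exact hu.1 (by simp)
  leading := by
    refine le_antisymm (Submodule.span_mono ?_) (Submodule.span_le.2 ?_)
    · rintro F ⟨g, hg, u, hu, rfl⟩
      exact ⟨g, Ghat_subset_N hbp hg, u, hu, rfl⟩
    · rintro F ⟨H, hH, u, hu, rfl⟩
      -- Not standard means divisible by the leading monomial of an element of `Ĝ`, which is all
      -- that is needed.
      have hns := notMem_standardM_of_isLeadingMonomial ha hb hbp hH hu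
      simp only [standardM, Set.mem_ofPred_eq, not_forall, not_not] at hns
      obtain ⟨α, hα, hle⟩ := hns
      obtain ⟨γ, hγ⟩ := exists_add_of_le hle
      obtain ⟨g, hg, hlow⟩ := hα.exists_mem_Ghat (K := K) (a := a) (d := d) ha hb hbp
      have hsplit : Finsupp.single u.2 (monomial u.1 (1 : K)) =
          (monomial γ (1 : K) : R K p) • Finsupp.single u.2 (monomial α (1 : K)) := by
        rw [Finsupp.smul_single, smul_eq_mul, monomial_mul, mul_one, hγ, add_comm α]
      rw [hsplit]
      exact Submodule.smul_mem _ _ (Submodule.subset_span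
        ⟨g, hg, (α, u.2), isLeadingMonomial_of_sub_mem hlow, rfl⟩)

end Leading

end MonCurve

end

theorem theorem6p1 {K : Type*} [Field K] (p a b d : ℕ) (hp : 2 ≤ p) (ha : 1 ≤ a)
    (hb : 1 ≤ b) (hbp : b ≤ p) (hd : 1 ≤ d) (hgcd : Nat.gcd (a * p + b) d = 1) :
    Ideal.span (Set.range (MonCurve.Gen.binomial K p a b d)) = MonCurve.wp K p a b d ∧
      MonCurve.IsGroebnerBasis (MonCurve.gtM p a b d) (MonCurve.N K p a b d)
        (MonCurve.Ghat K p a b d) :=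
  ⟨MonCurve.span_range_binomial hp ha hb hbp hgcd, MonCurve.isGroebnerBasis_Ghat ha hb hbp⟩
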